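/- Theorem (Mundici's conjecture). For an integer $Q\ge 2$ let $$F_Q=\left\{\frac{a}{q} : 1\le a\le q\le Q,\ \gcd(a,q)=1\right\}=\{\gamma_1<\gamma_2<\dots<\gamma_N\}$$ be the $Q$-th Farey sequence, let $$S_2(Q)=\sum_{j=1}^{N-1}(\gamma_{j+1}-\gamma_j)^2$$ be the sum of the squared gaps between its consecutive elements, and let $$C(Q)=\frac{Q^2\,S_2(Q)}{\log Q}.$$ Then $C(Q)<3$ for every integer $Q\ge 2$. The same inequality holds if the Farey sequence is taken to start at $\gamma_0=0/1$, that is, if the gap $\gamma_1-\gamma_0=1/Q$ is also counted, so that $S_2(Q)=\sum_{j=0}^{N-1}(\gamma_{j+1}-\gamma_j)^2$. -/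

import Mathlib

namespace Farey

/-- The `Q`-th Farey sequence as a set of fractions in `(0, 1]`:
all `a / q` with `1 ≤ a ≤ q ≤ Q` and `gcd(a, q) = 1`. -/
def F (Q : ℕ) : Finset ℚ :=
  ((Finset.Icc 1 Q ×ˢ Finset.Icc 1 Q).filter
    (fun p : ℕ × ℕ => p.1 ≤ p.2 ∧ Nat.Coprime p.1 p.2)).image
      (fun p : ℕ × ℕ => (p.1 : ℚ) / (p.2 : ℚ))

/-- The `Q`-th Farey sequence with the initial term `0 / 1` included, a subset of `[0, 1]`. -/
def F₀ (Q : ℕ) : Finset ℚ := insert 0 (F Q)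

/-- The sum of the squared gaps between consecutive elements of a finite set `s` of rationals:
if `γ 0 < γ 1 < ⋯ < γ (N - 1)` is the increasing enumeration of `s`, this is
`∑ (γ (j + 1) - γ j) ^ 2` over `0 ≤ j < N - 1`. -/
def sumSqGaps (s : Finset ℚ) : ℚ :=
  ∑ j : Fin (s.card - 1),
    (s.orderEmbOfFin rfl ⟨j.1 + 1, by omega⟩ - s.orderEmbOfFin rfl ⟨j.1, by omega⟩) ^ 2

/-- `S₂(Q)` for the Farey sequence in `(0, 1]`. -/
def S₂ (Q : ℕ) : ℚ := sumSqGaps (F Q)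

/-- `S₂(Q)` for the Farey sequence that starts at `0 / 1`: the gap from `0` to `1 / Q` counts. -/
def S₂₀ (Q : ℕ) : ℚ := sumSqGaps (F₀ Q)

/-- `C(Q) = S₂(Q) Q² / log Q` for the Farey sequence in `(0, 1]`. -/
noncomputable def C (Q : ℕ) : ℝ := (S₂ Q : ℝ) * (Q : ℝ) ^ 2 / Real.log Q

/-- `C(Q) = S₂(Q) Q² / log Q` for the Farey sequence that starts at `0 / 1`. -/
noncomputable def C₀ (Q : ℕ) : ℝ := (S₂₀ Q : ℝ) * (Q : ℝ) ^ 2 / Real.log Q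

end Farey

/-! Neighbours a/q < a'/q' of order n satisfy a'q - aq' = 1, so their gap is 1/(qq'), where q, q' ≤
n are coprime and q + q' > n; distinct gaps give distinct pairs (q, q'). Hence S₂, with or without
the term 0, is at most T(n), the sum of 1/(qq')² over all such pairs (`fareySqSum`).

Passing from n to m = n + 1 replaces each pair with q + q' = m by (q, m) and (m, q'), which lowers T
by 2(1/q + 1/q')/m³ per pair. So T(n) - T(n+1) ≤ 4H_{n+1}/(n+1)³. As T(n) ≤ 1/n tends to 0, summing
these drops to infinity gives T(n) ≤ (2H_n + 1)/n² (`fareySqSum_le`). This is less than 3 log n / n²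
for n ≥ 10; smaller n are computed. -/

/-! ### Mediant recursion for pairs of Farey denominators -/

/-- Ordered pairs of denominators of neighbouring Farey fractions of order `n`. -/
def fareyPairs (n : ℕ) : Finset (ℕ × ℕ) :=
  (Finset.Icc 1 n ×ˢ Finset.Icc 1 n).filter (fun p => Nat.Coprime p.1 p.2 ∧ n < p.1 + p.2)

/-- The sum of `1 / (q q')²` over the pairs of neighbouring Farey denominators. -/
def fareySqSum (n : ℕ) : ℚ := ∑ p ∈ fareyPairs n, 1 / ((p.1 : ℚ) * p.2) ^ 2

theorem mem_fareyPairs {n : ℕ} {p : ℕ × ℕ} : p ∈ fareyPairs n ↔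
    (1 ≤ p.1 ∧ p.1 ≤ n) ∧ (1 ≤ p.2 ∧ p.2 ≤ n) ∧ p.1.Coprime p.2 ∧ n < p.1 + p.2 := by
  simp [fareyPairs, and_assoc]

/-- Mediant insertion: exactly the pairs with q + q' = n + 1 disappear, and each yields (q, n + 1)
and (n + 1, q'). Coprimality of q and q' is that of q and n + 1. -/
theorem sum_fareyPairs_succ (f : ℕ → ℕ → ℚ) {n : ℕ} (hn : 1 ≤ n) :
    ∑ p ∈ fareyPairs (n + 1), f p.1 p.2 = ∑ p ∈ fareyPairs n, f p.1 p.2 +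
      ∑ q ∈ (Finset.Icc 1 n).filter (fun q => q.Coprime (n + 1)),
        (f q (n + 1) + f (n + 1) (n + 1 - q) - f q (n + 1 - q)) := by
  set A := (Finset.Icc 1 n).filter (fun q => q.Coprime (n + 1)) with hA
  have memA : ∀ q, q ∈ A ↔ (1 ≤ q ∧ q ≤ n) ∧ q.Coprime (n + 1) := by simp [hA]
  have cop : ∀ q q' : ℕ, q + q' = n + 1 → (q.Coprime q' ↔ q.Coprime (n + 1)) := by
    intro q q' h
    rw [← h]; simp
  have cop' : ∀ q q' : ℕ, q + q' = n + 1 → (q.Coprime q' ↔ q'.Coprime (n + 1)) := by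
    intro q q' h
    rw [Nat.coprime_comm, cop q' q (by omega)]
  have h0 : ∑ p ∈ (fareyPairs n).filter (fun p => p.1 + p.2 = n + 1), f p.1 p.2
      = ∑ q ∈ A, f q (n + 1 - q) := by
    refine (Finset.sum_bij' (fun q _ => (q, n + 1 - q)) (fun p _ => p.1) ?_ ?_ ?_ ?_ ?_).symm
    · intro q hq
      obtain ⟨h, hc⟩ := (memA q).1 hq
      rw [Finset.mem_filter, mem_fareyPairs]
      have := (cop q (n + 1 - q) (by omega)).2 hc
      exact ⟨⟨by simp only; omega, by simp only; omega, this, by simp only; omega⟩,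
        by simp only; omega⟩
    · intro p hp
      rw [Finset.mem_filter, mem_fareyPairs] at hp
      exact (memA _).2 ⟨hp.1.1, (cop _ _ hp.2).1 hp.1.2.2.1⟩
    · intro q _; rfl
    · intro p hp
      rw [Finset.mem_filter] at hp
      ext
      · rfl
      · simp only; omega
    · intro q _; rfl
  have h1 : ∑ p ∈ (fareyPairs (n + 1)).filter (fun p => p.2 = n + 1), f p.1 p.2
      = ∑ q ∈ A, f q (n + 1) := by
    refine (Finset.sum_bij' (fun q _ => (q, n + 1)) (fun p _ => p.1) ?_ ?_ ?_ ?_ ?_).symm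
    · intro q hq
      obtain ⟨h, hc⟩ := (memA q).1 hq
      rw [Finset.mem_filter, mem_fareyPairs]
      exact ⟨⟨by simp only; omega, by simp only; omega, hc, by simp only; omega⟩, rfl⟩
    · rintro ⟨p, p'⟩ hp
      rw [Finset.mem_filter, mem_fareyPairs] at hp
      obtain ⟨⟨a, b, c, d⟩, rfl⟩ := hp
      refine (memA _).2 ⟨⟨a.1, ?_⟩, c⟩
      rcases eq_or_ne p (n + 1) with h | h
      · simp only at c; rw [h, Nat.coprime_self] at c; omega
      · have := a.2; simp only at this ⊢; omega
    · intro q _; rfl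
    · intro p hp
      rw [Finset.mem_filter] at hp
      ext
      · rfl
      · simp only; omega
    · intro q _; rfl
  have h2 : ∑ p ∈ (fareyPairs (n + 1)).filter (fun p => ¬ p.2 = n + 1 ∧ p.1 = n + 1), f p.1 p.2
      = ∑ q ∈ A, f (n + 1) (n + 1 - q) := by
    refine (Finset.sum_bij' (fun q _ => (n + 1, n + 1 - q)) (fun p _ => n + 1 - p.2)
      ?_ ?_ ?_ ?_ ?_).symm
    · intro q hq
      obtain ⟨h, hc⟩ := (memA q).1 hq
      have := (cop' (n + 1 - q) q (by omega)).2 hc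
      have := (cop (n + 1 - q) q (by omega)).1 this
      rw [Finset.mem_filter, mem_fareyPairs]
      exact ⟨⟨by simp only; omega, by simp only; omega, this.symm, by simp only; omega⟩,
        by simp only; omega, rfl⟩
    · rintro ⟨p, p'⟩ hp
      rw [Finset.mem_filter, mem_fareyPairs] at hp
      obtain ⟨⟨a, b, c, d⟩, h, rfl⟩ := hp
      simp only at a b c d h
      have h' := (cop p' (n + 1 - p') (by omega)).2 c.symm
      exact (memA _).2 ⟨by simp only; omega, (cop' p' (n + 1 - p') (by omega)).1 h'⟩
    · intro q hq
      have := (memA q).1 hq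
      simp only; omega
    · intro p hp
      rw [Finset.mem_filter, mem_fareyPairs] at hp
      ext
      · exact hp.2.2.symm
      · simp only; omega
    · intro q _; rfl
  have h3 : (fareyPairs n).filter (fun p => ¬ p.1 + p.2 = n + 1) =
      (fareyPairs (n + 1)).filter (fun p => ¬ p.2 = n + 1 ∧ ¬ p.1 = n + 1) := by
    ext p
    rw [Finset.mem_filter, mem_fareyPairs, Finset.mem_filter, mem_fareyPairs]
    constructor
    · rintro ⟨⟨a, b, c, d⟩, e⟩
      exact ⟨⟨by omega, by omega, c, by omega⟩, by omega⟩
    · rintro ⟨⟨a, b, c, d⟩, e⟩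
      exact ⟨⟨by omega, by omega, c, by omega⟩, by omega⟩
  rw [Finset.sum_sub_distrib, Finset.sum_add_distrib, ← h0, ← h1, ← h2,
    ← Finset.sum_filter_add_sum_filter_not (fareyPairs n) (fun p => p.1 + p.2 = n + 1), h3,
    ← Finset.sum_filter_add_sum_filter_not (fareyPairs (n + 1)) (fun p => p.2 = n + 1),
    ← Finset.sum_filter_add_sum_filter_not
      ((fareyPairs (n + 1)).filter (fun p => ¬ p.2 = n + 1)) (fun p => p.1 = n + 1),
    Finset.filter_filter, Finset.filter_filter]
  ring

/-- The recursion preserves this sum, since 1/(qm) + 1/(mq') = 1/(qq') when m = q + q'. -/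
theorem sum_one_div_fareyPairs {n : ℕ} (hn : 1 ≤ n) :
    ∑ p ∈ fareyPairs n, 1 / ((p.1 : ℚ) * p.2) = 1 := by
  induction n, hn using Nat.le_induction with
  | base => decide +kernel
  | succ n hn ih =>
    rw [sum_fareyPairs_succ (fun q q' => 1 / ((q : ℚ) * q')) hn, ih, add_eq_left]
    refine Finset.sum_eq_zero fun q hq => ?_
    rw [Finset.mem_filter, Finset.mem_Icc] at hq
    have h1 : (0 : ℚ) < q := by exact_mod_cast hq.1.1
    have h2 : (0 : ℚ) < n + 1 - q := by
      have : (q : ℚ) ≤ n := by exact_mod_cast hq.1.2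
      linarith
    have h3 : (0 : ℚ) < n + 1 := by positivity
    rw [Nat.cast_sub (by omega)]
    push_cast
    field_simp
    ring

/-- Crude decay to 0, needed at infinity: (q - 1)(q' - 1) ≥ 0 gives qq' ≥ q + q' - 1 ≥ n. -/
theorem fareySqSum_le_one_div {n : ℕ} (hn : 1 ≤ n) : fareySqSum n ≤ 1 / n := by
  suffices fareySqSum n ≤ 1 / n * ∑ p ∈ fareyPairs n, 1 / ((p.1 : ℚ) * p.2) by
    rwa [sum_one_div_fareyPairs hn, mul_one] at this
  rw [Finset.mul_sum, fareySqSum]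
  refine Finset.sum_le_sum fun p hp => ?_
  obtain ⟨a, b, c, d⟩ := mem_fareyPairs.1 hp
  have hn' : (0 : ℚ) < n := by exact_mod_cast hn
  have h : (n : ℚ) ≤ p.1 * p.2 := by
    have : n ≤ p.1 * p.2 := by nlinarith [a.1, b.1, Nat.mul_le_mul a.1 b.1]
    exact_mod_cast this
  rw [pow_two, one_div_mul_one_div_rev]
  refine one_div_le_one_div_of_le (by nlinarith) ?_
  nlinarith

theorem fareySqSum_le_succ_add {n : ℕ} (hn : 1 ≤ n) :
    fareySqSum n ≤ fareySqSum (n + 1) + 4 * harmonic (n + 1) / (n + 1) ^ 3 := by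
  have key := sum_fareyPairs_succ (fun q q' => 1 / ((q : ℚ) * q') ^ 2) hn
  have hH : harmonic (n + 1) = ∑ q ∈ Finset.Icc 1 (n + 1), 1 / (q : ℚ) := by
    simp only [harmonic_eq_sum_Icc, one_div]
  have hn' : (0 : ℚ) < n + 1 := by positivity
  set A := (Finset.Icc 1 n).filter (fun q => q.Coprime (n + 1)) with hA
  have memA : ∀ q ∈ A, (1 ≤ q ∧ q ≤ n) ∧ q.Coprime (n + 1) := by simp [hA]
  have e1 : ∀ q ∈ A, (1 / ((q : ℚ) * ((n + 1 : ℕ) : ℚ)) ^ 2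
      + 1 / (((n + 1 : ℕ) : ℚ) * ((n + 1 - q : ℕ) : ℚ)) ^ 2
      - 1 / ((q : ℚ) * ((n + 1 - q : ℕ) : ℚ)) ^ 2) =
      - (2 / (n + 1) ^ 3) * (1 / (q : ℚ) + 1 / ((n + 1 - q : ℕ) : ℚ)) := by
    intro q hq
    obtain ⟨⟨h1, h2⟩, -⟩ := memA q hq
    have h1' : (0 : ℚ) < q := by exact_mod_cast h1
    have h2' : (0 : ℚ) < n + 1 - q := by
      have : (q : ℚ) ≤ n := by exact_mod_cast h2
      linarith
    rw [Nat.cast_sub (by omega)]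
    push_cast
    field_simp
    ring
  rw [Finset.sum_congr rfl e1, ← Finset.mul_sum, Finset.sum_add_distrib] at key
  have b1 : ∑ q ∈ A, 1 / (q : ℚ) ≤ harmonic (n + 1) := by
    rw [hH]
    refine Finset.sum_le_sum_of_subset_of_nonneg (fun q hq => ?_) (fun q _ _ => by positivity)
    have := memA q hq
    rw [Finset.mem_Icc]; omega
  have b2 : ∑ q ∈ A, 1 / ((n + 1 - q : ℕ) : ℚ) ≤ harmonic (n + 1) := by
    rw [hH, ← Finset.sum_image (f := fun q : ℕ => 1 / (q : ℚ)) (g := fun q => n + 1 - q)]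
    · refine Finset.sum_le_sum_of_subset_of_nonneg (fun q hq => ?_) (fun q _ _ => by positivity)
      obtain ⟨r, hr, rfl⟩ := Finset.mem_image.1 hq
      have := memA r hr
      rw [Finset.mem_Icc]; omega
    · intro q hq r hr h
      have h1 := memA q hq
      have h2 := memA r hr
      simp only at h
      omega
  have hc : (0 : ℚ) ≤ 2 / (n + 1) ^ 3 := by positivity
  have := mul_le_mul_of_nonneg_left (add_le_add b1 b2) hc
  have e : 4 * harmonic (n + 1) / (n + 1) ^ 3 =
    2 / ((n : ℚ) + 1) ^ 3 * (harmonic (n + 1) + harmonic (n + 1)) := by ring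
  rw [e]
  unfold fareySqSum
  linarith

/-! ### Telescoping against harmonic numbers -/

theorem one_le_harmonic {n : ℕ} (hn : 1 ≤ n) : 1 ≤ harmonic n := by
  induction n, hn using Nat.le_induction with
  | base => simp [harmonic]
  | succ n hn ih =>
    rw [harmonic_succ]
    have : (0 : ℚ) ≤ ((n + 1 : ℕ) : ℚ)⁻¹ := by positivity
    linarith

/-- A telescoping majorant for the drop of T. The summand 1 in 2H + 1 offsets, to leading order, the
loss from replacing H_{n+1} by H_n. -/
theorem four_mul_harmonic_div_le {n : ℕ} (hn : 1 ≤ n) :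
    4 * harmonic (n + 1) / (n + 1) ^ 3 ≤
      (2 * harmonic n + 1) / (n : ℚ) ^ 2 - (2 * harmonic (n + 1) + 1) / ((n + 1 : ℕ) : ℚ) ^ 2 := by
  have hn' : (0 : ℚ) < n := by exact_mod_cast hn
  have hK := one_le_harmonic (n := n + 1) (by omega)
  have e : harmonic n = harmonic (n + 1) - 1 / ((n : ℚ) + 1) := by
    rw [harmonic_succ]
    push_cast
    ring
  rw [← sub_nonneg, e]
  set K := harmonic (n + 1)
  have : (2 * (K - 1 / ((n : ℚ) + 1)) + 1) / (n : ℚ) ^ 2 - (2 * K + 1) / ((n + 1 : ℕ) : ℚ) ^ 2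
      - 4 * K / (n + 1) ^ 3 = (2 * K * (3 * n + 1) - (n + 1)) / ((n + 1) ^ 3 * n ^ 2) := by
    push_cast
    field_simp
    ring
  rw [this]
  apply div_nonneg _ (by positivity)
  nlinarith

theorem fareySqSum_le {n : ℕ} (hn : 1 ≤ n) : fareySqSum n ≤ (2 * harmonic n + 1) / (n : ℚ) ^ 2 := by
  have step : ∀ k : ℕ, fareySqSum n - (2 * harmonic n + 1) / (n : ℚ) ^ 2 ≤
      fareySqSum (n + k) - (2 * harmonic (n + k) + 1) / ((n + k : ℕ) : ℚ) ^ 2 := by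
    intro k
    induction k with
    | zero => simp
    | succ k ih =>
      have h1 := fareySqSum_le_succ_add (n := n + k) (by omega)
      have h2 := four_mul_harmonic_div_le (n := n + k) (by omega)
      rw [← add_assoc]
      linarith
  -- The difference between T and its bound is nondecreasing in n but at most 1/(n + k) at n + k, so
  -- it cannot be positive.
  by_contra! hlt
  obtain ⟨k, hk⟩ := exists_nat_one_div_lt (sub_pos.2 hlt)
  have h1 := step k
  have h2 := fareySqSum_le_one_div (n := n + k) (by omega)
  have h3 := one_le_harmonic (n := n + k) (by omega)
  have h4 : (0 : ℚ) ≤ (2 * harmonic (n + k) + 1) / ((n + k : ℕ) : ℚ) ^ 2 := by positivity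
  have h5 : 1 / ((n + k : ℕ) : ℚ) ≤ 1 / ((k : ℚ) + 1) := by
    refine one_div_le_one_div_of_le (by positivity) ?_
    have : k + 1 ≤ n + k := by omega
    exact_mod_cast this
  linarith

/-! ### Comparison with the logarithm -/

theorem two_mul_harmonic_add_one_lt {n : ℕ} (hn : 10 ≤ n) :
    2 * (harmonic n : ℝ) + 1 < 3 * Real.log n := by
  induction n, hn using Nat.le_induction with
  | base =>
    have h : 33 * Real.log 2 ≤ 10 * Real.log 10 := by
      have := Real.log_le_log (by norm_num) (show (2 : ℝ) ^ 33 ≤ 10 ^ 10 by norm_num)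
      rw [Real.log_pow, Real.log_pow] at this
      exact_mod_cast this
    have := Real.log_two_gt_d9
    have e : harmonic 10 = 7381 / 2520 := by decide +kernel
    rw [e]
    push_cast
    linarith
  | succ n hn ih =>
    have hn' : (0 : ℝ) < n := by
      have : 0 < n := by omega
      exact_mod_cast this
    have h := Real.one_sub_inv_le_log_of_pos (x := ((n : ℝ) + 1) / n) (by positivity)
    rw [Real.log_div (by positivity) (by positivity)] at h
    have e : 1 - (((n : ℝ) + 1) / n)⁻¹ = ((n : ℝ) + 1)⁻¹ := by
      field_simp
      ring
    have : (0 : ℝ) < ((n : ℝ) + 1)⁻¹ := by positivity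
    rw [e] at h
    rw [harmonic_succ]
    push_cast
    linarith

theorem fareySqSum_mul_sq_lt {n : ℕ} (hn : 1 < n) :
    (fareySqSum n : ℝ) * (n : ℝ) ^ 2 < 3 * Real.log n := by
  rcases le_or_gt 10 n with h | h
  · refine lt_of_le_of_lt ?_ (two_mul_harmonic_add_one_lt h)
    have := fareySqSum_le (n := n) (by omega)
    rw [le_div_iff₀ (by positivity)] at this
    exact_mod_cast this
  · have l2 := Real.log_two_gt_d9
    have hlog : ∀ (m k : ℕ), 2 ^ k ≤ m ^ 4 → k * Real.log 2 ≤ 4 * Real.log m := by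
      intro m k hmk
      have := Real.log_le_log (by positivity) (show (2 : ℝ) ^ k ≤ (m : ℝ) ^ 4 by exact_mod_cast hmk)
      rw [Real.log_pow, Real.log_pow] at this
      exact_mod_cast this
    -- The hypothesis on k gives log n ≥ (k/4) log 2, and log 2 > 69/100, so only a rational
    -- inequality remains to be decided.
    have key : ∀ k : ℕ, 2 ^ k ≤ n ^ 4 → fareySqSum n * n ^ 2 < 3 / 4 * k * (69 / 100) →
        (fareySqSum n : ℝ) * (n : ℝ) ^ 2 < 3 * Real.log n := by
      intro k h1 h2
      have h1 := hlog n k h1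
      have h2 : (fareySqSum n : ℝ) * (n : ℝ) ^ 2 < 3 / 4 * k * (69 / 100) := by
        have : ((fareySqSum n * n ^ 2 : ℚ) : ℝ) < ((3 / 4 * k * (69 / 100) : ℚ) : ℝ) := by
          exact_mod_cast h2
        push_cast at this
        exact this
      nlinarith [(Nat.cast_nonneg k : (0 : ℝ) ≤ k)]
    interval_cases n
    · exact key 4 (by norm_num) (by decide +kernel)
    · exact key 6 (by norm_num) (by decide +kernel)
    · exact key 8 (by norm_num) (by decide +kernel)
    · exact key 9 (by norm_num) (by decide +kernel)
    · exact key 10 (by norm_num) (by decide +kernel)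
    · exact key 11 (by norm_num) (by decide +kernel)
    · exact key 12 (by norm_num) (by decide +kernel)
    · exact key 12 (by norm_num) (by decide +kernel)

/-! ### Neighbouring Farey fractions -/

theorem den_intCast_div_le (u v : ℤ) (hv : 0 < v) : (((u : ℚ) / v).den : ℤ) ≤ v := by
  have := Rat.den_dvd u v
  rw [Rat.divInt_eq_div] at this
  exact Int.le_of_dvd hv this

/-- Two rationals with no rational of denominator at most `n` strictly between them are
separated by the mediant, so their denominators add up to more than `n`. -/
theorem lt_den_add_den {n : ℕ} {x y : ℚ} (hxy : x < y)
    (h : ∀ z : ℚ, x < z → z < y → n < z.den) : n < x.den + y.den := by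
  have hx : (0 : ℚ) < x.den := by exact_mod_cast x.den_pos
  have hy : (0 : ℚ) < y.den := by exact_mod_cast y.den_pos
  have ex := x.mul_den_eq_num
  have ey := y.mul_den_eq_num
  have hz := h (((x.num + y.num : ℤ) : ℚ) / ((x.den + y.den : ℤ) : ℚ)) (by
    push_cast
    rw [lt_div_iff₀ (by positivity), ← ex, ← ey]
    nlinarith) (by
    push_cast
    rw [div_lt_iff₀ (by positivity), ← ex, ← ey]
    nlinarith)
  have := den_intCast_div_le (x.num + y.num) (x.den + y.den) (by have := x.den_pos; omega)
  omega

theorem num_mul_den_sub_eq_one {n : ℕ} {x y : ℚ} (hxy : x < y) (hxn : x.den ≤ n)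
    (hyn : y.den ≤ n) (h : ∀ z : ℚ, x < z → z < y → n < z.den) :
    y.num * x.den - x.num * y.den = 1 := by
  set a := x.num with ha
  set q := x.den with hq
  set a' := y.num with ha'
  set q' := y.den with hq'
  have hq0 : 0 < (q : ℤ) := by exact_mod_cast x.den_pos
  have hq0' : 0 < (q' : ℤ) := by exact_mod_cast y.den_pos
  have ex : x = (a : ℚ) / q := x.num_div_den.symm
  have ey : y = (a' : ℚ) / q' := y.num_div_den.symm
  have hd : a * q' < a' * q := by
    rw [ex, ey, div_lt_div_iff₀ (by exact_mod_cast hq0) (by exact_mod_cast hq0')] at hxy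
    exact_mod_cast hxy
  -- A candidate successor u/v of x: a Bézout solution shifted along (a, q) until v lies in the
  -- window (n - q, n].
  obtain ⟨u, v, huv, hv, hvn⟩ : ∃ u v : ℤ, u * q - a * v = 1 ∧ (n : ℤ) - q < v ∧ v ≤ n := by
    have hc : IsCoprime a (q : ℤ) := Rat.isCoprime_num_den x
    obtain ⟨s, t, hst⟩ := hc
    refine ⟨t + a * (((n : ℤ) + s) / q), -s + q * (((n : ℤ) + s) / q), ?_, ?_, ?_⟩
    · linear_combination hst
    · have := Int.lt_mul_ediv_self_add (x := (n : ℤ) + s) hq0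
      linarith
    · have := Int.mul_ediv_self_le (x := (n : ℤ) + s) hq0.ne'
      linarith
  have hv0 : 0 < v := by omega
  have hvQ : (0 : ℚ) < v := by exact_mod_cast hv0
  have hqQ : (0 : ℚ) < q := by exact_mod_cast hq0
  have hqQ' : (0 : ℚ) < q' := by exact_mod_cast hq0'
  have hle : a' * v ≤ u * q' := by
    by_contra! hlt
    have := h ((u : ℚ) / v) (by
      rw [ex, div_lt_div_iff₀ hqQ hvQ]
      have : a * v < u * q := by linarith
      exact_mod_cast this) (by
      rw [ey, div_lt_div_iff₀ hvQ hqQ']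
      exact_mod_cast hlt)
    have := den_intCast_div_le u v hv0
    omega
  have hid : q' * (u * q - a * v) = q * (u * q' - a' * v) + v * (a' * q - a * q') := by ring
  -- Since y ≤ u/v, either y = u/v, or both brackets are at least 1 and q' ≥ q + v > n.
  rw [huv] at hid
  rcases hle.eq_or_lt with heq | hlt
  · have hdvd : v ∣ q' := ⟨a' * q - a * q', by rw [heq] at hid; linarith⟩
    have hdvd' : (q' : ℤ) ∣ v := by
      have hc : IsCoprime (q' : ℤ) a' := (Rat.isCoprime_num_den y).symm
      exact hc.dvd_of_dvd_mul_left ⟨u, by linarith⟩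
    have hvq : v = q' := Int.dvd_antisymm hv0.le hq0'.le hdvd hdvd'
    rw [heq, hvq] at hid
    have : (q' : ℤ) * 1 = q' * (a' * q - a * q') := by linarith
    exact (mul_left_cancel₀ hq0'.ne' this).symm
  · exfalso
    have h1 : (q : ℤ) * 1 ≤ q * (u * q' - a' * v) := mul_le_mul_of_nonneg_left (by omega) hq0.le
    have h2 : v * 1 ≤ v * (a' * q - a * q') := mul_le_mul_of_nonneg_left (by omega) hv0.le
    omega

theorem sub_eq_one_div_of_det {x y : ℚ} (h : y.num * x.den - x.num * y.den = 1) :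
    y - x = 1 / ((x.den : ℚ) * y.den) := by
  have hx : (0 : ℚ) < x.den := by exact_mod_cast x.den_pos
  have hy : (0 : ℚ) < y.den := by exact_mod_cast y.den_pos
  have h' : (y.num : ℚ) * x.den - x.num * y.den = 1 := by exact_mod_cast h
  rw [← x.mul_den_eq_num, ← y.mul_den_eq_num] at h'
  rw [eq_div_iff (by positivity)]
  linear_combination h'

/-- The determinant gives a q' ≡ -1 mod q, so q and q' fix a mod q, and 0 ≤ a < q fixes a. -/
theorem eq_of_det_of_den_eq {x y x' y' : ℚ} (hx : 0 ≤ x) (hx1 : x < 1) (hx' : 0 ≤ x')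
    (hx1' : x' < 1) (h : y.num * x.den - x.num * y.den = 1)
    (h' : y'.num * x'.den - x'.num * y'.den = 1) (hd : x.den = x'.den) (hd' : y.den = y'.den) :
    x = x' := by
  have hc : IsCoprime (x.den : ℤ) (y.den : ℤ) := ⟨y.num, -x.num, by linarith⟩
  rw [← hd, ← hd'] at h'
  have hdvd : (x.den : ℤ) ∣ x.num - x'.num :=
    hc.dvd_of_dvd_mul_right ⟨y.num - y'.num, by linarith⟩
  have l1 := Rat.num_nonneg.2 hx
  have l2 := Rat.num_nonneg.2 hx'
  have l3 := Rat.num_lt_denom_iff.2 hx1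
  have l4 := Rat.num_lt_denom_iff.2 hx1'
  rw [← hd] at l4
  have h0 : x.num - x'.num = 0 :=
    Int.eq_zero_of_abs_lt_dvd hdvd (abs_lt.2 ⟨by linarith, by linarith⟩)
  exact Rat.ext (by linarith) hd

/-! ### From gaps to pairs of denominators -/

/-- Closure under intermediate fractions makes consecutive elements Farey neighbours. An injection
of gaps into pairs suffices, as all terms are nonnegative; this covers both sequences at once. -/
theorem sumSqGaps_le_fareySqSum {n : ℕ} {s : Finset ℚ} (h0 : ∀ x ∈ s, 0 ≤ x)
    (h1 : ∀ x ∈ s, x ≤ 1) (hn : ∀ x ∈ s, x.den ≤ n)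
    (hs : ∀ x ∈ s, ∀ y ∈ s, ∀ z : ℚ, x < z → z < y → z.den ≤ n → z ∈ s) :
    Farey.sumSqGaps s ≤ fareySqSum n := by
  set g := s.orderEmbOfFin rfl with hg
  have mem : ∀ i, g i ∈ s := fun i => s.orderEmbOfFin_mem rfl i
  have lt : ∀ j : Fin (s.card - 1), g ⟨j.1, by omega⟩ < g ⟨j.1 + 1, by omega⟩ := by
    intro j
    rw [g.lt_iff_lt, Fin.mk_lt_mk]
    omega
  have gap : ∀ j : Fin (s.card - 1), ∀ z : ℚ, g ⟨j.1, by omega⟩ < z → z < g ⟨j.1 + 1, by omega⟩ →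
      n < z.den := by
    intro j z hz hz'
    by_contra! hle
    have hzs := hs _ (mem _) _ (mem _) z hz hz' hle
    have : z ∈ Set.range g := by rw [hg, Finset.range_orderEmbOfFin]; exact hzs
    obtain ⟨i, rfl⟩ := this
    rw [g.lt_iff_lt, Fin.lt_def] at hz hz'
    simp only at hz hz'
    omega
  have det := fun j => num_mul_den_sub_eq_one (lt j) (hn _ (mem _)) (hn _ (mem _)) (gap j)
  have inj : Function.Injective fun j : Fin (s.card - 1) =>
      ((g ⟨j.1, by omega⟩).den, (g ⟨j.1 + 1, by omega⟩).den) := by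
    intro i j hij
    simp only [Prod.mk.injEq] at hij
    have := eq_of_det_of_den_eq (h0 _ (mem _)) ((lt i).trans_le (h1 _ (mem _))) (h0 _ (mem _))
      ((lt j).trans_le (h1 _ (mem _))) (det i) (det j) hij.1 hij.2
    have := g.injective this
    rw [Fin.mk.injEq] at this
    exact Fin.ext this
  calc Farey.sumSqGaps s = ∑ j : Fin (s.card - 1),
        1 / (((g ⟨j.1, by omega⟩).den : ℚ) * (g ⟨j.1 + 1, by omega⟩).den) ^ 2 := by
        refine Finset.sum_congr rfl fun j _ => ?_
        rw [← hg, sub_eq_one_div_of_det (det j), one_div, one_div, inv_pow]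
    _ = ∑ p ∈ Finset.univ.image (fun j : Fin (s.card - 1) =>
          ((g ⟨j.1, by omega⟩).den, (g ⟨j.1 + 1, by omega⟩).den)),
          1 / ((p.1 : ℚ) * p.2) ^ 2 := by
        rw [Finset.sum_image fun i _ j _ hij => inj hij]
    _ ≤ fareySqSum n := by
        refine Finset.sum_le_sum_of_subset_of_nonneg (fun p hp => ?_) fun p _ _ => by positivity
        obtain ⟨j, -, rfl⟩ := Finset.mem_image.1 hp
        refine mem_fareyPairs.2 ⟨⟨Rat.den_pos _, hn _ (mem _)⟩, ⟨Rat.den_pos _, hn _ (mem _)⟩, ?_,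
          lt_den_add_den (lt j) (gap j)⟩
        exact Nat.isCoprime_iff_coprime.1
          ⟨(g ⟨j.1 + 1, by omega⟩).num, -(g ⟨j.1, by omega⟩).num, by linarith [det j]⟩

theorem mem_F {Q : ℕ} {x : ℚ} : x ∈ Farey.F Q ↔ 0 < x ∧ x ≤ 1 ∧ x.den ≤ Q := by
  simp only [Farey.F, Finset.mem_image, Finset.mem_filter, Finset.mem_product, Finset.mem_Icc,
    Prod.exists]
  constructor
  · rintro ⟨a, q, ⟨⟨⟨ha, -⟩, hq, hqQ⟩, haq, -⟩, rfl⟩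
    have ha' : (0 : ℚ) < a := by exact_mod_cast ha
    have hq' : (0 : ℚ) < q := by exact_mod_cast hq
    refine ⟨by positivity, ?_, ?_⟩
    · rw [div_le_one hq']
      exact_mod_cast haq
    · have := den_intCast_div_le a q (by exact_mod_cast hq)
      push_cast at this
      omega
  · rintro ⟨h0, h1, hQ⟩
    have hnum := Rat.num_pos.2 h0
    have hle : x.num ≤ x.den := Rat.num_le_denom_iff.2 h1
    have := x.den_pos
    refine ⟨x.num.natAbs, x.den, ⟨⟨⟨by omega, by omega⟩, by omega, hQ⟩, by omega, x.reduced⟩, ?_⟩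
    have : ((x.num.natAbs : ℕ) : ℚ) = (x.num : ℚ) := by
      rw [Nat.cast_natAbs, abs_of_pos hnum]
    rw [this, x.num_div_den]

theorem S₂_le_fareySqSum (Q : ℕ) : Farey.S₂ Q ≤ fareySqSum Q := by
  refine sumSqGaps_le_fareySqSum (fun x hx => (mem_F.1 hx).1.le) (fun x hx => (mem_F.1 hx).2.1)
    (fun x hx => (mem_F.1 hx).2.2) fun x hx y hy z hxz hzy hz => ?_
  exact mem_F.2 ⟨(mem_F.1 hx).1.trans hxz, hzy.le.trans (mem_F.1 hy).2.1, hz⟩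

theorem mem_F₀ {Q : ℕ} (hQ : 1 ≤ Q) {x : ℚ} :
    x ∈ Farey.F₀ Q ↔ 0 ≤ x ∧ x ≤ 1 ∧ x.den ≤ Q := by
  rw [Farey.F₀, Finset.mem_insert, mem_F]
  constructor
  · rintro (rfl | h)
    · exact ⟨le_rfl, zero_le_one, hQ⟩
    · exact ⟨h.1.le, h.2⟩
  · rintro ⟨h0, h⟩
    rcases h0.eq_or_lt with h0 | h0
    · exact Or.inl h0.symm
    · exact Or.inr ⟨h0, h⟩

theorem S₂₀_le_fareySqSum {Q : ℕ} (hQ : 1 ≤ Q) : Farey.S₂₀ Q ≤ fareySqSum Q := by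
  refine sumSqGaps_le_fareySqSum (fun x hx => ((mem_F₀ hQ).1 hx).1)
    (fun x hx => ((mem_F₀ hQ).1 hx).2.1) (fun x hx => ((mem_F₀ hQ).1 hx).2.2)
    fun x hx y hy z hxz hzy hz => ?_
  exact (mem_F₀ hQ).2 ⟨((mem_F₀ hQ).1 hx).1.trans hxz.le, hzy.le.trans ((mem_F₀ hQ).1 hy).2.1, hz⟩

theorem theorem1 : ∀ Q : ℕ, 1 < Q → Farey.C Q < 3 ∧ Farey.C₀ Q < 3 := by
  intro Q hQ
  have hlog : 0 < Real.log Q := Real.log_pos (by exact_mod_cast hQ)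
  have main : ∀ r : ℚ, r ≤ fareySqSum Q → (r : ℝ) * (Q : ℝ) ^ 2 / Real.log Q < 3 := by
    intro r hr
    rw [div_lt_iff₀ hlog]
    refine lt_of_le_of_lt ?_ (fareySqSum_mul_sq_lt hQ)
    have : (r : ℝ) ≤ (fareySqSum Q : ℝ) := by exact_mod_cast hr
    gcongr
  exact ⟨main _ (S₂_le_fareySqSum Q), main _ (S₂₀_le_fareySqSum hQ.le)⟩
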